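/- For a finite simple graph $G$ with vertex set $\{1,\dots,N\}$ (the sites), let $\mathcal F$ be the fermionic Fock space with modes $(i,\sigma)$, $1\le i\le N$, $\sigma\in\{\uparrow,\downarrow\}$, with creation and annihilation operators $c_{i\sigma}^\dagger,c_{i\sigma}$ and number operators $n_{i\sigma}=c_{i\sigma}^\dagger c_{i\sigma}$, and let $$H=-\sum_{i\sim j,\ \sigma}h_{ij}\,c_{i\sigma}^\dagger c_{j\sigma}+\sum_i\xi_i\,n_{i\uparrow}n_{i\downarrow}$$ (the first sum is over ordered pairs of neighbours) be a Fermi-Hubbard Hamiltonian with real coefficients $h_{ij}=h_{ji}$, $|h_{ij}|\le1$, $|\xi_i|\le1$. An operator is supported on a set $S$ of sites (is of the form $O_S\otimes I$) if it lies in the algebra generated by the $c_{i\sigma},c_{i\sigma}^\dagger$ with $i\in S$. A single-site unitary is a unitary operator that is supported on one site and commutes or anticommutes with the fermion parity $(-1)^{\sum_{i,\sigma}n_{i\sigma}}$. For all integers $k,\mathfrak d\ge0$ there is a constant $K$, depending only on $k$ and $\mathfrak d$ (in particular not on the system size $N$), such that the following holds for every $N$, every $G$ of maximum degree at most $\mathfrak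 d$, every $H$ as above, and every set $C$ of at most $k$ sites. Let $\mathcal D$ be a probability distribution on the finite products of single-site unitaries such that $$\mathbb E_{U\sim\mathcal D}[U^\dagger HU]=H_{\mathrm{eff}}^C+H_{\mathrm{env}},$$ where $H_{\mathrm{eff}}^C$ is supported on $C$ and $H_{\mathrm{env}}$ is supported on the complement of $C$. Let $r\ge1$, let $U_1,\dots,U_r$ be independent with law $\mathcal D$, let $t\in\mathbb R$ and $\tau=t/r$. Then for every operator $O_C$ supported on $C$ with $\|O_C\|\le1$ the random operator below is integrable and, in operator norm, $$\Big\|\,\mathbb E\Big[(U_1^\dagger e^{iH\tau}U_1)\cdots(U_r^\dagger e^{iH\tau}U_r)\,O_C\,(U_r^\dagger e^{-iH\tau}U_r)\cdots(U_1^\dagger e^{-iH\tau}U_1)\Big]-e^{iH_{\mathrm{eff}}^Ct}\,O_C\,e^{-iH_{\mathrm{eff}}^Ct}\Big\|\le K\,\frac{t^2}{r}.$$ -/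

import Mathlib

namespace FermiHubbard

/-- The spin orbitals of a chain of `N` sites, ordered as `1↑, 1↓, 2↑, 2↓, …`.
The Boolean is the spin: `false` is `↑` and `true` is `↓`. -/
abbrev Mode (N : ℕ) : Type := Fin N ×ₗ Bool

/-- The spin orbital of spin `σ` on site `i`. -/
abbrev mode {N : ℕ} (i : Fin N) (σ : Bool) : Mode N := toLex (i, σ)

/-- The fermionic Fock space (the exterior algebra of `ℂ^(2N)` with its Hilbert space structure) in
the occupation number basis: the orthonormal basis vector indexed by a finite set `S` of spin
orbitals is the wedge product, in increasing order, of the spin orbitals in `S`. -/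
abbrev Fock (N : ℕ) : Type := EuclideanSpace ℂ (Finset (Mode N))

/-- Operators on Fock space, with the operator norm; `star` is the Hermitian adjoint. -/
abbrev Op (N : ℕ) : Type := Fock N →L[ℂ] Fock N

/-- The creation operator `c†` of the spin orbital `m`, i.e. the left wedge product with `m`: it
sends the basis vector of `S` to `(-1)^#{m' ∈ S | m' < m}` times the basis vector of
`insert m S` if `m ∉ S`, and to `0` if `m ∈ S`. -/
noncomputable def create {N : ℕ} (m : Mode N) : Op N :=
  Matrix.toEuclideanCLM (𝕜 := ℂ) (n := Finset (Mode N))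
    (Matrix.of fun T S : Finset (Mode N) =>
      if m ∉ S ∧ T = insert m S then (-1 : ℂ) ^ (S.filter (fun m' => m' < m)).card else 0)

/-- The annihilation operator `c`, the Hermitian adjoint of `c†`. -/
noncomputable def annihilate {N : ℕ} (m : Mode N) : Op N := star (create m)

/-- The number operator `n = c† c`. -/
noncomputable def number {N : ℕ} (m : Mode N) : Op N := create m * annihilate m

/-- The Fermi-Hubbard Hamiltonian
`H = - ∑_{i ∼ j, σ} h i j c†_{iσ} c_{jσ} + ∑_i ξ i n_{i↑} n_{i↓}` on a graph; the first sum runs over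
all ordered pairs of neighbours. -/
noncomputable def hamiltonian {N : ℕ} (G : SimpleGraph (Fin N)) [DecidableRel G.Adj]
    (h : Fin N → Fin N → ℝ) (ξ : Fin N → ℝ) : Op N :=
  -(∑ i : Fin N, ∑ j ∈ G.neighborFinset i, ∑ σ : Bool,
      ((h i j : ℝ) : ℂ) • (create (mode i σ) * annihilate (mode j σ)))
    + ∑ i : Fin N, ((ξ i : ℝ) : ℂ) • (number (mode i false) * number (mode i true))

/-- The operators supported on a set `S` of sites (those of the form `O_S ⊗ I`): the algebra
generated by the creation and annihilation operators of the spin orbitals on the sites in `S`. -/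
noncomputable def supportedOn {N : ℕ} (S : Finset (Fin N)) : Subalgebra ℂ (Op N) :=
  Algebra.adjoin ℂ
    {a | ∃ i ∈ S, ∃ σ : Bool, a = create (mode i σ) ∨ a = annihilate (mode i σ)}

/-- The fermion parity operator `(-1)^(total particle number)`. -/
noncomputable def parity (N : ℕ) : Op N :=
  Matrix.toEuclideanCLM (𝕜 := ℂ) (n := Finset (Mode N))
    (Matrix.diagonal fun S : Finset (Mode N) => (-1 : ℂ) ^ S.card)

/-- A single-site unitary: a unitary operator supported on one site that is even or odd, i.e.
commutes or anticommutes with the fermion parity. -/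
def IsSingleSiteUnitary {N : ℕ} (u : Op N) : Prop :=
  u ∈ unitary (Op N) ∧ (∃ i : Fin N, u ∈ supportedOn {i}) ∧
    (parity N * u = u * parity N ∨ parity N * u = -(u * parity N))

/-- The finite products of single-site unitaries. -/
noncomputable def productUnitaries (N : ℕ) : Submonoid (Op N) :=
  Submonoid.closure {u | IsSingleSiteUnitary u}

/-- The propagator `e^{i s A}`. -/
noncomputable def propagator {N : ℕ} (A : Op N) (s : ℝ) : Op N :=
  NormedSpace.exp ((Complex.I * (s : ℂ)) • A)

/-- The reshaped Heisenberg evolution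
`∏→_{1 ≤ l ≤ r} (U_l† e^{iHτ} U_l) * O * ∏←_{1 ≤ l ≤ r} (U_l† e^{-iHτ} U_l)`,
where `∏→ A_l = A_1 A_2 ⋯ A_r` and `∏← A_l = A_r ⋯ A_2 A_1`. -/
noncomputable def reshapedEvolution {N r : ℕ} (H : Op N) (τ : ℝ) (U : Fin r → Op N)
    (O : Op N) : Op N :=
  (List.ofFn fun l => star (U l) * propagator H τ * U l).prod * O *
    (List.ofFn fun l => star (U l) * propagator H (-τ) * U l).reverse.prod

end FermiHubbard

open MeasureTheory ProbabilityTheory FermiHubbard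

/-! One step of the reshaped evolution, averaged over the random unitary, is a linear map `T` on
operators. Since the `U_l` are independent, the expectation in the theorem is `T^r O`. Each step is
conjugation by a unitary, so `T` does not increase norms. It therefore suffices to show that `T B`
differs from the evolution `heisenberg X τ B` by at most `K τ²` for every `B` on the exact orbit of
`O`: the errors then add up to `r K (t/r)² = K t²/r`. The exact orbit stays in the algebra of `C`
and in the unit ball; the orbit under `T` may spread, but it is never used as a point of comparison.

For one step, both maps are expanded to first order in `τ`. The first-order terms agree, because the
averaged Hamiltonian and its part on `C` have the same commutator with every `B` supported on `C`.
The remainders are controlled by double commutators, and locality makes these independent of `N`.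
Conjugation by products of single-site unitaries preserves supports and evenness
(`productUnitaries_conj`), and an even operator commutes with every operator on disjoint sites
(`IsEven.commute`). Hence only the site terms near `C` contribute (`conj_hamiltonian_commutator`).

`Heff` and `Henv` are not assumed to be self-adjoint or even. Both defects are harmless, because
only their sum is constrained: the odd part and the anti-self-adjoint part of `Heff` equal, up to
sign, those of `Henv`, so they live on `C` and on its complement at once. The odd part must then
vanish, and the anti-self-adjoint part commutes with the algebra of `C`. So
`exists_selfAdjoint_part` replaces `Heff` by its self-adjoint part `X`. -/

namespace FermiHubbard

/-! ### Canonical anticommutation relations in the occupation number basis. -/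

section Fock

variable {N : ℕ}

/-- The sign acquired when the mode `m` is moved to its place in `S`. -/
noncomputable def jwSign (m : Mode N) (S : Finset (Mode N)) : ℂ :=
  (-1) ^ (S.filter (fun m' => m' < m)).card

/-- The occupation number basis vector of `S`. -/
noncomputable abbrev ket (S : Finset (Mode N)) : Fock N := EuclideanSpace.single S 1

theorem Op.star_neg (A : Op N) : star (-A) = -star A := _root_.star_neg A

theorem Op.star_add (A B : Op N) : star (A + B) = star A + star B := StarAddMonoid.star_add A B

theorem Op.neg_mul (A B : Op N) : -A * B = -(A * B) := _root_.neg_mul A B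

theorem Op.mul_neg (A B : Op N) : A * -B = -(A * B) := _root_.mul_neg A B

theorem Op.norm_star (A : Op N) : ‖star A‖ = ‖A‖ := _root_.norm_star A

theorem Op.ext_ket {A B : Op N} (h : ∀ S, A (ket S) = B (ket S)) : A = B := by
  apply ContinuousLinearMap.coe_injective
  apply (EuclideanSpace.basisFun (Finset (Mode N)) ℂ).toBasis.ext
  intro S
  simpa using h S

theorem jwSign_mul_self (m : Mode N) (S : Finset (Mode N)) : jwSign m S * jwSign m S = 1 := by
  rw [jwSign, ← pow_add, ← two_mul, pow_mul]; simp

theorem jwSign_insert {m n : Mode N} {S : Finset (Mode N)} (hn : n ∉ S) :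
    jwSign m (insert n S) = if n < m then -jwSign m S else jwSign m S := by
  unfold jwSign
  rw [Finset.filter_insert]
  split_ifs with h
  · rw [Finset.card_insert_of_notMem (by simp [hn]), pow_succ]; ring
  · rfl

theorem jwSign_erase {m n : Mode N} {S : Finset (Mode N)} (hn : n ∈ S) :
    jwSign m (S.erase n) = if n < m then -jwSign m S else jwSign m S := by
  conv_rhs => rw [← Finset.insert_erase hn, jwSign_insert (Finset.notMem_erase n S)]
  split_ifs <;> simp

theorem toEuclideanCLM_ket (M : Matrix (Finset (Mode N)) (Finset (Mode N)) ℂ)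
    (S T : Finset (Mode N)) :
    (Matrix.toEuclideanCLM (𝕜 := ℂ) (n := Finset (Mode N)) M (ket S)) T = M T S := by
  simp [ket, Matrix.ofLp_toEuclideanCLM]

theorem create_ket (m : Mode N) (S : Finset (Mode N)) :
    create m (ket S) = if m ∈ S then 0 else jwSign m S • ket (insert m S) := by
  ext T
  rw [create, toEuclideanCLM_ket]
  by_cases h : m ∈ S <;> by_cases hT : T = insert m S <;>
    simp [h, hT, jwSign]

theorem annihilate_ket (m : Mode N) (S : Finset (Mode N)) :
    annihilate m (ket S) = if m ∈ S then jwSign m S • ket (S.erase m) else 0 := by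
  ext T
  rw [annihilate, create, ← map_star, toEuclideanCLM_ket, Matrix.star_eq_conjTranspose,
    Matrix.conjTranspose_apply, Matrix.of_apply]
  by_cases h : m ∈ S
  · by_cases hT : T = S.erase m
    · subst hT
      have := jwSign_erase (m := m) h
      simp only [lt_irrefl, if_false] at this
      simp [h, ← this]
      simp [jwSign]
    · have : ¬ (m ∉ T ∧ S = insert m T) := by
        rintro ⟨h1, rfl⟩; exact hT (by rw [Finset.erase_insert h1])
      simp [h, hT, this]
  · have : ¬ (m ∉ T ∧ S = insert m T) := by
      rintro ⟨h1, rfl⟩; simp at h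
    simp [h, this]

theorem parity_ket (S : Finset (Mode N)) : parity N (ket S) = (-1 : ℂ) ^ S.card • ket S := by
  ext T
  rw [parity, toEuclideanCLM_ket, Matrix.diagonal_apply]
  by_cases hT : T = S <;> simp [hT]

theorem parity_mul_parity : parity N * parity N = 1 := by
  apply Op.ext_ket
  intro S
  simp only [mul_apply_eq_comp, parity_ket, map_smul, smul_smul,
    one_apply_eq_self]
  rw [← pow_add, ← two_mul, pow_mul]; simp

theorem star_parity : star (parity N) = parity N := by
  rw [parity, ← map_star, Matrix.star_eq_conjTranspose, Matrix.diagonal_conjTranspose]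
  congr 2
  ext S
  simp

theorem parity_mul_create (m : Mode N) : parity N * create m = -(create m * parity N) := by
  apply Op.ext_ket
  intro S
  by_cases h : m ∈ S
  · simp [create_ket, parity_ket, h]
  · simp [create_ket, parity_ket, h, smul_smul, pow_succ, mul_comm]

theorem parity_mul_annihilate (m : Mode N) :
    parity N * annihilate m = -(annihilate m * parity N) := by
  have := congrArg star (parity_mul_create m)
  simp only [star_mul, Op.star_neg, star_parity] at this
  rw [annihilate, this, neg_neg]

theorem create_mul_create {m n : Mode N} (h : m ≠ n) :
    create m * create n = -(create n * create m) := by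
  apply Op.ext_ket
  intro S
  by_cases hm : m ∈ S <;> by_cases hn : n ∈ S <;>
    simp [create_ket, hm, hn, h, h.symm]
  rw [jwSign_insert hm, jwSign_insert hn, Finset.insert_comm]
  rcases lt_or_gt_of_ne h with h' | h' <;>
    simp [h', not_lt_of_gt h', smul_smul, mul_comm]

theorem annihilate_mul_annihilate {m n : Mode N} (h : m ≠ n) :
    annihilate m * annihilate n = -(annihilate n * annihilate m) := by
  have := congrArg star (create_mul_create h.symm)
  simp only [star_mul, Op.star_neg] at this
  exact this

theorem create_mul_annihilate {m n : Mode N} (h : m ≠ n) :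
    create m * annihilate n = -(annihilate n * create m) := by
  apply Op.ext_ket
  intro S
  by_cases hm : m ∈ S <;> by_cases hn : n ∈ S <;>
    simp [create_ket, annihilate_ket, hm, hn, h, h.symm]
  rw [jwSign_insert hm, jwSign_erase hn, Finset.erase_insert_of_ne h]
  rcases lt_or_gt_of_ne h with h' | h' <;>
    simp [h', not_lt_of_gt h', smul_smul, mul_comm]

theorem create_mul_annihilate_self (m : Mode N) :
    create m * annihilate m + annihilate m * create m = 1 := by
  apply Op.ext_ket
  intro S
  by_cases hm : m ∈ S
  · simp [create_ket, annihilate_ket, hm, smul_smul,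
      jwSign_erase hm, jwSign_mul_self]
  · simp [create_ket, annihilate_ket, hm, smul_smul,
      jwSign_insert hm, jwSign_mul_self]

/-- Taking the expectation of `c† c + c c† = 1` in a vector `v` gives `‖c v‖² + ‖c† v‖² = ‖v‖²`. -/
theorem norm_create_le (m : Mode N) : ‖create m‖ ≤ 1 := by
  refine ContinuousLinearMap.opNorm_le_bound _ zero_le_one fun v => ?_
  have h := congrArg (fun A : Op N => inner ℂ (A v) v) (create_mul_annihilate_self m)
  have h1 : inner ℂ ((create m * annihilate m) v) v = ((‖annihilate m v‖ ^ 2 : ℝ) : ℂ) := by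
    rw [mul_apply_eq_comp, ← ContinuousLinearMap.adjoint_inner_right,
      ← ContinuousLinearMap.star_eq_adjoint]
    exact (inner_self_eq_norm_sq_to_K (𝕜 := ℂ) _).trans (by push_cast; rfl)
  have h2 : inner ℂ ((annihilate m * create m) v) v = ((‖create m v‖ ^ 2 : ℝ) : ℂ) := by
    rw [mul_apply_eq_comp, annihilate, ContinuousLinearMap.star_eq_adjoint,
      ContinuousLinearMap.adjoint_inner_left]
    exact (inner_self_eq_norm_sq_to_K (𝕜 := ℂ) _).trans (by push_cast; rfl)
  simp only [add_apply, inner_add_left, h1, h2,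
    one_apply_eq_self] at h
  have h3 : inner ℂ v v = ((‖v‖ ^ 2 : ℝ) : ℂ) :=
    (inner_self_eq_norm_sq_to_K (𝕜 := ℂ) _).trans (by push_cast; rfl)
  rw [h3] at h
  have h4 : ‖annihilate m v‖ ^ 2 + ‖create m v‖ ^ 2 = ‖v‖ ^ 2 := by exact_mod_cast h
  rw [one_mul]
  exact le_of_sq_le_sq (by nlinarith [sq_nonneg ‖annihilate m v‖]) (norm_nonneg _)

theorem norm_annihilate_le (m : Mode N) : ‖annihilate m‖ ≤ 1 := by
  rw [annihilate, Op.norm_star]; exact norm_create_le m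

/-! ### Parity, supports, and conjugation by single-site unitaries. -/

/-- Operators commuting with the fermion parity. -/
def IsEven (A : Op N) : Prop := parity N * A = A * parity N

/-- Operators anticommuting with the fermion parity. -/
def IsOdd (A : Op N) : Prop := parity N * A = -(A * parity N)

/-- The creation and annihilation operators on the sites in `S`. -/
def generators (S : Finset (Fin N)) : Set (Op N) :=
  {a | ∃ i ∈ S, ∃ σ : Bool, a = create (mode i σ) ∨ a = annihilate (mode i σ)}

theorem supportedOn_eq (S : Finset (Fin N)) :
    supportedOn S = Algebra.adjoin ℂ (generators S) := rfl

theorem generators_subset (S : Finset (Fin N)) : generators S ⊆ supportedOn S :=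
  Algebra.subset_adjoin

theorem supportedOn_mono {S T : Finset (Fin N)} (h : S ⊆ T) : supportedOn S ≤ supportedOn T :=
  Algebra.adjoin_mono fun _ ⟨i, hi, hs⟩ => ⟨i, h hi, hs⟩

theorem create_mem {S : Finset (Fin N)} {i : Fin N} (h : i ∈ S) (σ : Bool) :
    create (mode i σ) ∈ supportedOn S :=
  generators_subset S ⟨i, h, σ, Or.inl rfl⟩

theorem annihilate_mem {S : Finset (Fin N)} {i : Fin N} (h : i ∈ S) (σ : Bool) :
    annihilate (mode i σ) ∈ supportedOn S :=
  generators_subset S ⟨i, h, σ, Or.inr rfl⟩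

theorem star_mem_supportedOn {S : Finset (Fin N)} {A : Op N} (h : A ∈ supportedOn S) :
    star A ∈ supportedOn S := by
  rw [supportedOn_eq] at h
  induction h using Algebra.adjoin_induction with
  | mem x hx =>
    obtain ⟨i, hi, σ, rfl | rfl⟩ := hx
    · exact annihilate_mem hi σ
    · rw [annihilate, star_star]; exact create_mem hi σ
  | algebraMap z =>
    rw [Algebra.algebraMap_eq_smul_one, star_smul, star_one]
    exact (supportedOn S).smul_mem (one_mem _) _
  | add x y _ _ hx hy => rw [Op.star_add]; exact add_mem hx hy
  | mul x y _ _ hx hy => rw [star_mul]; exact mul_mem hy hx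

theorem isOdd_of_mem_generators {S : Finset (Fin N)} {a : Op N} (h : a ∈ generators S) :
    IsOdd a := by
  obtain ⟨i, -, σ, rfl | rfl⟩ := h
  · exact parity_mul_create _
  · exact parity_mul_annihilate _

theorem IsOdd.parity_conj {A : Op N} (h : IsOdd A) : parity N * A * parity N = -A := by
  rw [h, Op.neg_mul, mul_assoc, parity_mul_parity, mul_one]

theorem IsEven.parity_conj {A : Op N} (h : IsEven A) : parity N * A * parity N = A := by
  rw [h, mul_assoc, parity_mul_parity, mul_one]

theorem isEven_of_parity_conj {A : Op N} (h : parity N * A * parity N = A) : IsEven A := by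
  unfold IsEven
  conv_rhs => rw [← h, mul_assoc, parity_mul_parity, mul_one]

theorem parity_conj_mul (A B : Op N) :
    parity N * (A * B) * parity N =
      (parity N * A * parity N) * (parity N * B * parity N) := by
  calc _ = parity N * A * 1 * B * parity N := by noncomm_ring
    _ = _ := by rw [← parity_mul_parity]; noncomm_ring

theorem parity_conj_conj (A : Op N) :
    parity N * (parity N * A * parity N) * parity N = A := by
  calc _ = (parity N * parity N) * A * (parity N * parity N) := by noncomm_ring
    _ = A := by rw [parity_mul_parity]; noncomm_ring

theorem parity_conj_algebraMap (z : ℂ) :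
    parity N * algebraMap ℂ (Op N) z * parity N = algebraMap ℂ (Op N) z := by
  rw [← Algebra.commutes, mul_assoc, parity_mul_parity, mul_one]

theorem parity_conj_mem {S : Finset (Fin N)} {A : Op N} (h : A ∈ supportedOn S) :
    parity N * A * parity N ∈ supportedOn S := by
  rw [supportedOn_eq] at h
  induction h using Algebra.adjoin_induction with
  | mem x hx =>
    rw [(isOdd_of_mem_generators hx).parity_conj]
    exact neg_mem (generators_subset S hx)
  | algebraMap z =>
    rw [parity_conj_algebraMap]
    exact (supportedOn S).algebraMap_mem z
  | add x y _ _ hx hy => rw [mul_add, add_mul]; exact add_mem hx hy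
  | mul x y _ _ hx hy => rw [parity_conj_mul]; exact mul_mem hx hy

theorem generators_anticommute {S T : Finset (Fin N)} (hST : Disjoint S T) {a b : Op N}
    (ha : a ∈ generators S) (hb : b ∈ generators T) : a * b = -(b * a) := by
  obtain ⟨i, hi, σ, ha⟩ := ha
  obtain ⟨j, hj, ρ, hb⟩ := hb
  have hij : mode i σ ≠ mode j ρ := by
    intro h
    have : i = j := congrArg (fun x => (ofLex x).1) h
    exact Finset.disjoint_left.1 hST hi (this ▸ hj)
  rcases ha with rfl | rfl <;> rcases hb with rfl | rfl
  · exact create_mul_create hij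
  · exact create_mul_annihilate hij
  · rw [create_mul_annihilate hij.symm, neg_neg]
  · exact annihilate_mul_annihilate hij

/-- Moving `b` past a word of length `n` in generators on other sites costs `(-1)^n`, which is
exactly the sign that conjugation by the parity puts on that word. Both sides are compatible with
sums and products, so the rule extends to the whole algebra. -/
theorem mul_generator {S T : Finset (Fin N)} (hST : Disjoint S T) {A b : Op N}
    (hA : A ∈ supportedOn S) (hb : b ∈ generators T) :
    A * b = b * (parity N * A * parity N) := by
  rw [supportedOn_eq] at hA
  induction hA using Algebra.adjoin_induction with
  | mem x hx =>
    rw [(isOdd_of_mem_generators hx).parity_conj, generators_anticommute hST hx hb, Op.mul_neg]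
  | algebraMap z => rw [parity_conj_algebraMap, Algebra.commutes]
  | add x y _ _ hx hy => rw [add_mul, hx, hy, mul_add, add_mul, mul_add]
  | mul x y _ _ hx hy =>
    rw [mul_assoc, hy, ← mul_assoc, hx, parity_conj_mul, mul_assoc]

theorem IsEven.commute {S T : Finset (Fin N)} (hST : Disjoint S T) {A B : Op N}
    (hA : A ∈ supportedOn S) (he : IsEven A) (hB : B ∈ supportedOn T) : Commute A B := by
  rw [supportedOn_eq] at hB
  induction hB using Algebra.adjoin_induction with
  | mem x hx => rw [Commute, SemiconjBy, mul_generator hST hA hx, he.parity_conj]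
  | algebraMap z => exact (Algebra.commutes z A).symm
  | add x y _ _ hx hy => exact hx.add_right hy
  | mul x y _ _ hx hy => exact hx.mul_right hy

theorem IsOdd.mul_eq {S T : Finset (Fin N)} (hST : Disjoint S T) {A B : Op N}
    (hA : A ∈ supportedOn S) (ho : IsOdd A) (hB : B ∈ supportedOn T) :
    A * B = (parity N * B * parity N) * A := by
  rw [supportedOn_eq] at hB
  induction hB using Algebra.adjoin_induction with
  | mem x hx =>
    rw [mul_generator hST hA hx, ho.parity_conj, (isOdd_of_mem_generators hx).parity_conj,
      Op.mul_neg, Op.neg_mul]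
  | algebraMap z => rw [parity_conj_algebraMap, Algebra.commutes]
  | add x y _ _ hx hy => rw [mul_add, hx, hy, mul_add, add_mul, add_mul]
  | mul x y _ _ hx hy =>
    rw [← mul_assoc, hx, mul_assoc, hy, parity_conj_mul, ← mul_assoc]

/-- If the site of `u` lies in `S`, everything happens inside one algebra. Otherwise an even `u`
leaves `A` unchanged, and an odd `u` turns it into its parity conjugate, which has the same support.
-/
theorem IsSingleSiteUnitary.conj_mem {u : Op N} (hu : IsSingleSiteUnitary u)
    {S : Finset (Fin N)} {A : Op N} (hA : A ∈ supportedOn S) :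
    star u * A * u ∈ supportedOn S := by
  obtain ⟨huu, ⟨i, hi⟩, hp⟩ := hu
  by_cases hiS : i ∈ S
  · have := supportedOn_mono (Finset.singleton_subset_iff.2 hiS) hi
    exact mul_mem (mul_mem (star_mem_supportedOn this) hA) this
  · have hd : Disjoint {i} S := Finset.disjoint_singleton_left.2 hiS
    rcases hp with he | ho
    · have hc := IsEven.commute hd hi he hA
      rw [mul_assoc, ← hc.eq, ← mul_assoc, Unitary.star_mul_self_of_mem huu, one_mul]
      exact hA
    -- The rule is applied to the parity conjugate of `A`, so that the second twist restores `A`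
    -- itself and `A * u` can be rewritten with `u` on the left.
    · have hc := IsOdd.mul_eq hd hi ho (parity_conj_mem hA)
      rw [parity_conj_conj] at hc
      rw [mul_assoc, ← hc, ← mul_assoc, Unitary.star_mul_self_of_mem huu, one_mul]
      exact parity_conj_mem hA

theorem IsEven.star {A : Op N} (hA : IsEven A) : IsEven (star A) := by
  have := congrArg Star.star hA
  simp only [star_mul, star_parity] at this
  exact this.symm

theorem IsOdd.star {A : Op N} (hA : IsOdd A) : IsOdd (star A) := by
  have := congrArg Star.star hA
  simp only [star_mul, Op.star_neg, star_parity] at this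
  rw [IsOdd, this, neg_neg]

theorem IsEven.mul {A B : Op N} (hA : IsEven A) (hB : IsEven B) : IsEven (A * B) :=
  Commute.mul_right hA hB

theorem IsEven.add {A B : Op N} (hA : IsEven A) (hB : IsEven B) : IsEven (A + B) :=
  Commute.add_right hA hB

theorem IsEven.sub {A B : Op N} (hA : IsEven A) (hB : IsEven B) : IsEven (A - B) :=
  Commute.sub_right hA hB

theorem IsEven.neg {A : Op N} (hA : IsEven A) : IsEven (-A) :=
  Commute.neg_right hA

theorem IsEven.smul {A : Op N} (hA : IsEven A) (z : ℂ) : IsEven (z • A) :=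
  Commute.smul_right hA z

theorem IsEven.sum {ι : Type*} {s : Finset ι} {A : ι → Op N} (h : ∀ i ∈ s, IsEven (A i)) :
    IsEven (∑ i ∈ s, A i) :=
  Commute.sum_right s A _ h

theorem IsOdd.mul {A B : Op N} (hA : IsOdd A) (hB : IsOdd B) : IsEven (A * B) := by
  unfold IsEven
  rw [← mul_assoc, hA, Op.neg_mul, mul_assoc, hB, Op.mul_neg, neg_neg, mul_assoc]

theorem IsSingleSiteUnitary.conj_isEven {u : Op N} (hu : IsSingleSiteUnitary u)
    {A : Op N} (hA : IsEven A) : IsEven (star u * A * u) := by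
  obtain ⟨-, -, he | ho⟩ := hu
  · exact (IsEven.mul (IsEven.star he) hA).mul he
  · have h1 : IsOdd (A * u) := by
      unfold IsOdd
      rw [← mul_assoc, hA, mul_assoc, ho, Op.mul_neg, mul_assoc]
    rw [mul_assoc]
    exact IsOdd.mul (IsOdd.star ho) h1

/-- Conjugation by a product of single-site unitaries preserves supports and evenness. -/
theorem productUnitaries_conj {u : Op N} (hu : u ∈ productUnitaries N) :
    u ∈ unitary (Op N) ∧
      (∀ (S : Finset (Fin N)) (A : Op N), A ∈ supportedOn S → star u * A * u ∈ supportedOn S) ∧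
      ∀ A : Op N, IsEven A → IsEven (star u * A * u) := by
  rw [productUnitaries] at hu
  induction hu using Submonoid.closure_induction with
  | mem u hu => exact ⟨hu.1, fun S A => hu.conj_mem, fun A => hu.conj_isEven⟩
  | one => exact ⟨one_mem _, by simp, by simp⟩
  | mul u v _ _ hu hv =>
    have key : ∀ A : Op N, Star.star (u * v) * A * (u * v) =
        Star.star v * (Star.star u * A * u) * v := by
      intro A; rw [star_mul]; noncomm_ring
    refine ⟨mul_mem hu.1 hv.1, fun S A hA => ?_, fun A hA => ?_⟩
    · rw [key]; exact hv.2.1 _ _ (hu.2.1 _ _ hA)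
    · rw [key]; exact hv.2.2 _ (hu.2.2 _ hA)

/-- An odd operator supported on a set of sites and on its complement vanishes. -/
theorem IsOdd.eq_zero {S T : Finset (Fin N)} (hST : Disjoint S T) {A : Op N}
    (ho : IsOdd A) (hS : A ∈ supportedOn S) (hT : A ∈ supportedOn T) : A = 0 := by
  -- Regarding `star A` as supported on `S` and `A` as supported on `T` gives `star A * A = -A *
  -- star A`. Expectations on the left are nonnegative and those on the right nonpositive, so both
  -- vanish.
  have h := IsOdd.mul_eq hST (star_mem_supportedOn hS) ho.star hT
  rw [ho.parity_conj] at h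
  ext1 v
  have h2 := congrArg (fun B : Op N => inner ℂ (B v) v) h
  have h3 : inner ℂ ((Star.star A * A) v) v = ((‖A v‖ ^ 2 : ℝ) : ℂ) := by
    rw [mul_apply_eq_comp, ContinuousLinearMap.star_eq_adjoint,
      ContinuousLinearMap.adjoint_inner_left]
    exact (inner_self_eq_norm_sq_to_K (𝕜 := ℂ) _).trans (by push_cast; rfl)
  have h4 : inner ℂ ((-A * Star.star A) v) v = ((-‖Star.star A v‖ ^ 2 : ℝ) : ℂ) := by
    rw [mul_apply_eq_comp, neg_apply, inner_neg_left,
      ← ContinuousLinearMap.adjoint_inner_right, ← ContinuousLinearMap.star_eq_adjoint]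
    refine (congrArg Neg.neg (inner_self_eq_norm_sq_to_K (𝕜 := ℂ) _)).trans (by push_cast; rfl)
  simp only [h3, h4] at h2
  have h5 : ‖A v‖ ^ 2 = -‖Star.star A v‖ ^ 2 := by exact_mod_cast h2
  have h6 : ‖A v‖ ^ 2 = 0 := le_antisymm (by rw [h5]; nlinarith [sq_nonneg ‖Star.star A v‖])
    (sq_nonneg _)
  simpa using h6

/-- The summands of an even operator that splits over two disjoint sets of sites are even. -/
theorem isEven_of_isEven_add {S T : Finset (Fin N)} (hST : Disjoint S T) {A B : Op N}
    (hA : A ∈ supportedOn S) (hB : B ∈ supportedOn T) (h : IsEven (A + B)) : IsEven A := by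
  -- These differences are twice the odd parts. Since the odd parts of `A` and `B` cancel, that of
  -- `A` is supported on both `S` and `T`.
  have h1 : A - parity N * A * parity N = -(B - parity N * B * parity N) := by
    have := h.parity_conj
    rw [mul_add, add_mul] at this
    rw [← sub_eq_zero] at this ⊢
    rw [← neg_eq_zero, ← this]
    abel
  have h2 : IsOdd (A - parity N * A * parity N) := by
    have h3 : parity N * (A - parity N * A * parity N) * parity N
        = -(A - parity N * A * parity N) := by
      rw [mul_sub, sub_mul, parity_conj_conj]; abel
    unfold IsOdd
    rw [← Op.neg_mul, ← h3, mul_assoc _ (parity N) (parity N), parity_mul_parity, mul_one]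
  have h4 := h2.eq_zero hST (sub_mem hA (parity_conj_mem hA))
    (h1 ▸ neg_mem (sub_mem hB (parity_conj_mem hB)))
  exact isEven_of_parity_conj (sub_eq_zero.1 h4).symm

/-! ### Locality of the Hamiltonian and size-independent commutator bounds. -/

variable (G : SimpleGraph (Fin N)) [DecidableRel G.Adj]

/-- A site together with its neighbours. -/
def closedNbhd (i : Fin N) : Finset (Fin N) := insert i (G.neighborFinset i)

/-- The sites at distance at most one from `S`. -/
def thicken (S : Finset (Fin N)) : Finset (Fin N) := S.biUnion (closedNbhd G)

variable {G}

theorem mem_closedNbhd_comm {i j : Fin N} : i ∈ closedNbhd G j ↔ j ∈ closedNbhd G i := by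
  simp [closedNbhd, eq_comm, G.adj_comm]

theorem disjoint_closedNbhd_of_notMem_thicken {S : Finset (Fin N)} {i : Fin N}
    (h : i ∉ thicken G S) : Disjoint (closedNbhd G i) S := by
  rw [Finset.disjoint_right]
  intro j hj hji
  exact h (Finset.mem_biUnion.2 ⟨j, hj, mem_closedNbhd_comm.1 hji⟩)

theorem closedNbhd_subset_thicken {S : Finset (Fin N)} {i : Fin N} (h : i ∈ S) :
    closedNbhd G i ⊆ thicken G S :=
  Finset.subset_biUnion_of_mem _ h

theorem subset_thicken (S : Finset (Fin N)) : S ⊆ thicken G S := fun _ hi =>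
  closedNbhd_subset_thicken hi (Finset.mem_insert_self _ _)

theorem card_thicken_le {d : ℕ} (hd : ∀ i, G.degree i ≤ d) (S : Finset (Fin N)) :
    (thicken G S).card ≤ S.card * (d + 1) := by
  refine Finset.card_biUnion_le_card_mul _ _ _ fun i _ => ?_
  exact (Finset.card_insert_le _ _).trans (Nat.succ_le_succ (hd i))

variable (G) (h : Fin N → Fin N → ℝ) (ξ : Fin N → ℝ)

/-- The part of the Fermi-Hubbard Hamiltonian attached to the site `i`. -/
noncomputable def siteTerm (i : Fin N) : Op N :=
  -(∑ j ∈ G.neighborFinset i, ∑ σ : Bool,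
      ((h i j : ℝ) : ℂ) • (create (mode i σ) * annihilate (mode j σ)))
    + ((ξ i : ℝ) : ℂ) • (number (mode i false) * number (mode i true))

theorem hamiltonian_eq_sum : hamiltonian G h ξ = ∑ i, siteTerm G h ξ i := by
  simp only [hamiltonian, siteTerm]
  rw [Finset.sum_add_distrib]
  congr 1
  exact (Finset.sum_neg_distrib _).symm

theorem siteTerm_mem (i : Fin N) : siteTerm G h ξ i ∈ supportedOn (closedNbhd G i) := by
  have hi : i ∈ closedNbhd G i := Finset.mem_insert_self _ _
  refine add_mem (neg_mem (sum_mem fun j hj => sum_mem fun σ _ => ?_)) ?_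
  · exact (supportedOn _).smul_mem
      (mul_mem (create_mem hi σ) (annihilate_mem (Finset.mem_insert_of_mem hj) σ)) _
  · exact (supportedOn _).smul_mem (mul_mem (mul_mem (create_mem hi _) (annihilate_mem hi _))
      (mul_mem (create_mem hi _) (annihilate_mem hi _))) _

theorem isEven_create_mul_annihilate (m n : Mode N) : IsEven (create m * annihilate n) :=
  IsOdd.mul (parity_mul_create m) (parity_mul_annihilate n)

theorem siteTerm_isEven (i : Fin N) : IsEven (siteTerm G h ξ i) :=
  ((IsEven.sum fun _ _ => IsEven.sum fun _ _ =>
      (isEven_create_mul_annihilate _ _).smul _).neg).add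
    (((isEven_create_mul_annihilate _ _).mul (isEven_create_mul_annihilate _ _)).smul _)

theorem hamiltonian_isEven : IsEven (hamiltonian G h ξ) := by
  rw [hamiltonian_eq_sum]
  exact IsEven.sum fun i _ => siteTerm_isEven G h ξ i

theorem norm_create_mul_annihilate_le (m n : Mode N) : ‖create m * annihilate n‖ ≤ 1 :=
  (norm_mul_le _ _).trans
    (mul_le_one₀ (norm_create_le m) (norm_nonneg _) (norm_annihilate_le n))

variable {G h ξ}

/-- There are two spins for each of at most `d` neighbours, plus one interaction term, all of norm
at most one. -/
theorem norm_siteTerm_le {d : ℕ} (hd : ∀ i, G.degree i ≤ d)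
    (hh : ∀ i j, G.Adj i j → |h i j| ≤ 1) (hξ : ∀ i, |ξ i| ≤ 1) (i : Fin N) :
    ‖siteTerm G h ξ i‖ ≤ 2 * d + 1 := by
  have hs : ∀ (x : ℝ) (A : Op N), |x| ≤ 1 → ‖A‖ ≤ 1 → ‖(x : ℂ) • A‖ ≤ 1 := fun x A hx hA => by
    rw [norm_smul, Complex.norm_real, Real.norm_eq_abs]
    exact mul_le_one₀ hx (norm_nonneg _) hA
  refine (norm_add_le _ _).trans (add_le_add ?_ ?_)
  · rw [norm_neg]
    refine (norm_sum_le_of_le (G.neighborFinset i) (f := fun j => ∑ σ : Bool,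
      ((h i j : ℝ) : ℂ) • (create (mode i σ) * annihilate (mode j σ))) (n := fun _ => (2 : ℝ))
      fun j hj => ?_).trans ?_
    · refine (norm_sum_le_of_le (n := fun _ => (1 : ℝ)) _ fun σ _ =>
        hs _ _ (hh i j (by simpa using hj)) (norm_create_mul_annihilate_le _ _)).trans ?_
      simp
    · rw [Finset.sum_const, nsmul_eq_mul, mul_comm, G.card_neighborFinset_eq_degree]
      have : (G.degree i : ℝ) ≤ d := by exact_mod_cast hd i
      linarith
  · exact hs _ _ (hξ i) ((norm_mul_le _ _).trans (mul_le_one₀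
      (norm_create_mul_annihilate_le _ _) (norm_nonneg _) (norm_create_mul_annihilate_le _ _)))

theorem star_create_mul_annihilate (m n : Mode N) :
    star (create m * annihilate n) = create n * annihilate m := by
  rw [star_mul, annihilate, annihilate, star_star]

theorem number_ket (m : Mode N) (S : Finset (Mode N)) :
    number m (ket S) = if m ∈ S then ket S else 0 := by
  by_cases h : m ∈ S
  · simp [number, annihilate_ket, create_ket, h, smul_smul, jwSign_erase h, jwSign_mul_self]
  · simp [number, annihilate_ket, h]

theorem number_commute (m n : Mode N) : Commute (number m) (number n) := by
  apply Op.ext_ket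
  intro S
  by_cases hm : m ∈ S <;> by_cases hn : n ∈ S <;> simp [number_ket, hm, hn]

theorem hamiltonian_star (hsymm : ∀ i j, G.Adj i j → h i j = h j i) :
    star (hamiltonian G h ξ) = hamiltonian G h ξ := by
  have hreal : ∀ (x : ℝ) (A : Op N), star ((x : ℂ) • A) = (x : ℂ) • star A := fun x A => by
    rw [star_smul]; congr 1; exact Complex.conj_ofReal x
  unfold hamiltonian
  rw [Op.star_add, Op.star_neg]
  refine congrArg₂ (· + ·) (congrArg Neg.neg ?_) ?_
  -- As a sum over all pairs with an adjacency indicator, the hopping term allows the two summations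
  -- to be exchanged; the adjoint exchanges the roles of `i` and `j`.
  · have hkey : ∀ i : Fin N, (∑ j ∈ G.neighborFinset i, ∑ σ : Bool,
        ((h i j : ℝ) : ℂ) • (create (mode i σ) * annihilate (mode j σ))) =
        ∑ j : Fin N, if G.Adj i j then ∑ σ : Bool,
          ((h i j : ℝ) : ℂ) • (create (mode i σ) * annihilate (mode j σ)) else 0 := fun i => by
      rw [← Finset.sum_filter]
      congr 1
      ext j; simp
    simp only [hkey]
    refine (map_sum (starAddEquiv : Op N ≃+ Op N) _ _).trans ?_
    simp only [map_sum]
    rw [Finset.sum_comm]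
    refine Finset.sum_congr rfl fun i _ => Finset.sum_congr rfl fun j _ => ?_
    by_cases hij : G.Adj i j
    · rw [if_pos hij, if_pos hij.symm, map_sum]
      refine Finset.sum_congr rfl fun σ _ => ?_
      refine (hreal _ _).trans ?_
      rw [star_create_mul_annihilate, hsymm i j hij]
    · rw [if_neg hij, if_neg fun hji => hij hji.symm, map_zero]
  · refine (map_sum (starAddEquiv : Op N ≃+ Op N) _ _).trans ?_
    refine Finset.sum_congr rfl fun i _ => ?_
    refine (hreal _ _).trans ?_
    rw [star_mul]
    congr 1
    have hn : ∀ m : Mode N, star (number m) = number m := fun m =>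
      star_create_mul_annihilate m m
    rw [hn, hn]
    exact (number_commute _ _).eq.symm

theorem norm_conj_le {u : Op N} (hu : u ∈ unitary (Op N)) (A : Op N) :
    ‖star u * A * u‖ = ‖A‖ := by
  rw [CStarRing.norm_mul_mem_unitary _ hu, CStarRing.norm_mem_unitary_mul _ (Unitary.star_mem hu)]

theorem conj_hamiltonian (u : Op N) :
    star u * hamiltonian G h ξ * u = ∑ i, star u * siteTerm G h ξ i * u := by
  rw [hamiltonian_eq_sum, Finset.mul_sum, Finset.sum_mul]

/-- A conjugated site term is still even and still supported on the closed neighbourhood of its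
site, so it commutes with `O` once that neighbourhood misses `S`. This removes the dependence on
`N`. -/
theorem conj_hamiltonian_commutator {u : Op N} (hu : u ∈ productUnitaries N)
    {S : Finset (Fin N)} {O : Op N} (hO : O ∈ supportedOn S) :
    star u * hamiltonian G h ξ * u * O - O * (star u * hamiltonian G h ξ * u) =
      ∑ i ∈ thicken G S,
        (star u * siteTerm G h ξ i * u * O - O * (star u * siteTerm G h ξ i * u)) := by
  rw [conj_hamiltonian, Finset.sum_mul, Finset.mul_sum, ← Finset.sum_sub_distrib]
  refine (Finset.sum_subset (Finset.subset_univ _) fun i _ hi => ?_).symm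
  obtain ⟨-, h1, h2⟩ := productUnitaries_conj hu
  exact sub_eq_zero.2 (IsEven.commute (disjoint_closedNbhd_of_notMem_thicken hi)
    (h1 _ _ (siteTerm_mem G h ξ i)) (h2 _ (siteTerm_isEven G h ξ i)) hO).eq

/-- The surviving sites lie in `thicken G S`, and their terms reach one step further. Knowing this
support allows the commutator bound to be applied a second time. -/
theorem conj_hamiltonian_commutator_mem {u : Op N} (hu : u ∈ productUnitaries N)
    {S : Finset (Fin N)} {O : Op N} (hO : O ∈ supportedOn S) :
    star u * hamiltonian G h ξ * u * O - O * (star u * hamiltonian G h ξ * u) ∈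
      supportedOn (thicken G (thicken G S)) := by
  rw [conj_hamiltonian_commutator hu hO]
  refine sum_mem fun i hi => ?_
  have h1 := supportedOn_mono (closedNbhd_subset_thicken hi)
    ((productUnitaries_conj hu).2.1 _ _ (siteTerm_mem G h ξ i))
  have h2 := supportedOn_mono ((subset_thicken (G := G) S).trans (subset_thicken (G := G) _)) hO
  exact sub_mem (mul_mem h1 h2) (mul_mem h2 h1)

/-- The norm of the commutator of the Hamiltonian with a local operator is bounded independently
of the size of the system. -/
theorem norm_conj_hamiltonian_commutator_le {d : ℕ} (hd : ∀ i, G.degree i ≤ d)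
    (hh : ∀ i j, G.Adj i j → |h i j| ≤ 1) (hξ : ∀ i, |ξ i| ≤ 1)
    {u : Op N} (hu : u ∈ productUnitaries N)
    {S : Finset (Fin N)} {k : ℕ} (hS : S.card ≤ k) {O : Op N} (hO : O ∈ supportedOn S) :
    ‖star u * hamiltonian G h ξ * u * O - O * (star u * hamiltonian G h ξ * u)‖ ≤
      k * (d + 1) * (2 * (2 * d + 1)) * ‖O‖ := by
  rw [conj_hamiltonian_commutator hu hO]
  refine (norm_sum_le_of_le (n := fun _ => 2 * (2 * (d : ℝ) + 1) * ‖O‖) _ fun i _ => ?_).trans ?_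
  · have h1 : ‖star u * siteTerm G h ξ i * u‖ ≤ 2 * d + 1 := by
      rw [norm_conj_le (productUnitaries_conj hu).1]
      exact norm_siteTerm_le hd hh hξ i
    calc _ ≤ ‖star u * siteTerm G h ξ i * u‖ * ‖O‖ + ‖O‖ * ‖star u * siteTerm G h ξ i * u‖ :=
          (norm_sub_le _ _).trans (add_le_add (norm_mul_le _ _) (norm_mul_le _ _))
      _ ≤ _ := by nlinarith [norm_nonneg O]
  · rw [Finset.sum_const, nsmul_eq_mul]
    -- At most `k * (d + 1)` sites contribute; each commutator costs twice the norm bound `2 * d +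
    -- 1` of a site term.
    have h1 : (((thicken G S).card : ℕ) : ℝ) ≤ k * (d + 1) := by
      exact_mod_cast (card_thicken_le hd S).trans (Nat.mul_le_mul_right _ hS)
    calc _ ≤ (k * (d + 1) : ℝ) * (2 * (2 * d + 1) * ‖O‖) := by gcongr
      _ = _ := by ring

end Fock

/-! ### Heisenberg evolution in a C⋆-algebra. -/

section CStar

variable {A : Type*} [CStarAlgebra A]

/-- `e^{isX}` in a C⋆-algebra. -/
noncomputable def expI (X : A) (s : ℝ) : A := NormedSpace.exp ((Complex.I * (s : ℂ)) • X)

theorem expI_eq (X : A) (s : ℝ) : expI X s = NormedSpace.exp (s • (Complex.I • X)) := by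
  rw [expI, mul_comm, mul_smul, Complex.coe_smul]

theorem expI_zero (X : A) : expI X 0 = 1 := by
  simp [expI_eq]

theorem exp_add_eq_mul_exp {X Y : A} (h : Commute X Y) :
    NormedSpace.exp (X + Y) = NormedSpace.exp X * NormedSpace.exp Y := by
  let : NormedAlgebra ℚ A := NormedAlgebra.restrictScalars ℚ ℂ A
  exact NormedSpace.exp_add_of_commute h

theorem expI_add (X : A) (s t : ℝ) : expI X (s + t) = expI X s * expI X t := by
  rw [expI_eq, expI_eq, expI_eq, add_smul]
  exact exp_add_eq_mul_exp (((Commute.refl (Complex.I • X)).smul_left s).smul_right t)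

theorem expI_mul_neg (X : A) (s : ℝ) : expI X s * expI X (-s) = 1 := by
  rw [← expI_add, add_neg_cancel, expI_zero]

theorem expI_add_left {X Y : A} (h : Commute X Y) (s : ℝ) :
    expI (X + Y) s = expI X s * expI Y s := by
  rw [expI, smul_add]
  exact exp_add_eq_mul_exp ((h.smul_left _).smul_right _)

theorem star_expI {X : A} (hX : star X = X) (s : ℝ) : star (expI X s) = expI X (-s) := by
  rw [expI, NormedSpace.star_exp, expI, star_smul, hX]
  simp

theorem expI_mem_unitary {X : A} (hX : star X = X) (s : ℝ) : expI X s ∈ unitary A := by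
  have h := expI_mul_neg X (-s)
  rw [neg_neg] at h
  rw [Unitary.mem_iff, star_expI hX]
  exact ⟨h, expI_mul_neg X s⟩

theorem hasDerivAt_expI (X : A) (s : ℝ) :
    HasDerivAt (expI X) (expI X s * (Complex.I • X)) s := by
  rw [show expI X = fun s : ℝ => NormedSpace.exp (s • (Complex.I • X)) from funext (expI_eq X)]
  exact hasDerivAt_exp_smul_const (𝕂 := ℝ) (Complex.I • X) s

theorem hasDerivAt_expI_neg (X : A) (s : ℝ) :
    HasDerivAt (fun s => expI X (-s)) (-((Complex.I • X) * expI X (-s))) s := by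
  have h : (fun s => expI X (-s)) = fun s : ℝ => NormedSpace.exp (s • -(Complex.I • X)) := by
    funext s; rw [expI_eq]; congr 1; rw [neg_smul, smul_neg]
  have h2 := hasDerivAt_exp_smul_const' (𝕂 := ℝ) (-(Complex.I • X)) s
  rw [← congrFun h s, neg_mul] at h2
  rw [h]
  exact h2

/-- The Heisenberg evolution `e^{isX} B e^{-isX}`. -/
noncomputable def heisenberg (X : A) (s : ℝ) (B : A) : A := expI X s * B * expI X (-s)

theorem heisenberg_zero (X B : A) : heisenberg X 0 B = B := by
  simp [heisenberg, expI_zero]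

theorem norm_heisenberg {X : A} (hX : star X = X) (s : ℝ) (B : A) :
    ‖heisenberg X s B‖ = ‖B‖ := by
  rw [heisenberg, CStarRing.norm_mul_mem_unitary _ (expI_mem_unitary hX _),
    CStarRing.norm_mem_unitary_mul _ (expI_mem_unitary hX _)]

theorem hasDerivAt_heisenberg (X B : A) (s : ℝ) :
    HasDerivAt (fun s => heisenberg X s B)
      (Complex.I • heisenberg X s (X * B - B * X)) s := by
  have h := ((hasDerivAt_expI X s).mul_const B).mul (hasDerivAt_expI_neg X s)
  refine h.congr_deriv ?_
  rw [heisenberg, mul_neg, ← sub_eq_add_neg, mul_sub, sub_mul, smul_sub]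
  simp only [mul_assoc, mul_smul_comm, smul_mul_assoc]

/-- Mean value inequality: the derivative is the evolved commutator, whose norm is constant in time
because the evolution is isometric. -/
theorem norm_heisenberg_sub_le {X : A} (hX : star X = X) (s : ℝ) (B : A) :
    ‖heisenberg X s B - B‖ ≤ ‖X * B - B * X‖ * |s| := by
  have h := convex_univ.norm_image_sub_le_of_norm_hasDerivWithin_le
    (f := fun s => heisenberg X s B) (C := ‖X * B - B * X‖)
    (fun s _ => (hasDerivAt_heisenberg X B s).hasDerivWithinAt)
    (fun s _ => by rw [norm_smul, Complex.norm_I, one_mul, norm_heisenberg hX])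
    (Set.mem_univ (0 : ℝ)) (Set.mem_univ s)
  simpa [heisenberg_zero] using h

/-- Second order Taylor estimate for the Heisenberg evolution. -/
theorem norm_heisenberg_sub_sub_le {X : A} (hX : star X = X) (s : ℝ) (B : A) :
    ‖heisenberg X s B - B - (Complex.I * s) • (X * B - B * X)‖ ≤
      ‖X * (X * B - B * X) - (X * B - B * X) * X‖ * s ^ 2 := by
  set E := X * B - B * X
  have hd : ∀ x : ℝ, HasDerivAt (fun s : ℝ => heisenberg X s B - s • (Complex.I • E))
      (Complex.I • heisenberg X x E - Complex.I • E) x := fun x => by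
    refine (hasDerivAt_heisenberg X B x).sub ?_
    simpa using (hasDerivAt_id x).smul_const (Complex.I • E)
  -- The derivative at `x` is `Complex.I` times the displacement of `E` under the evolution, hence
  -- at most `‖X * E - E * X‖ * |x|` by the first-order estimate. Bounding `|x|` by `|s|` on the
  -- ball loses only the factor `1/2` of Taylor's formula and handles both signs of `s`.
  have h := (convex_closedBall (0 : ℝ) |s|).norm_image_sub_le_of_norm_hasDerivWithin_le
    (f := fun s : ℝ => heisenberg X s B - s • (Complex.I • E))
    (C := ‖X * E - E * X‖ * |s|)
    (fun x _ => (hd x).hasDerivWithinAt)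
    (fun x hx => by
      rw [← smul_sub, norm_smul, Complex.norm_I, one_mul]
      refine (norm_heisenberg_sub_le hX x E).trans ?_
      exact mul_le_mul_of_nonneg_left (by simpa using hx) (norm_nonneg _))
    (x := 0) (y := s) (by simp) (by simp)
  simp only [heisenberg_zero, zero_smul, sub_zero, Real.norm_eq_abs] at h
  rw [mul_assoc, ← sq, sq_abs] at h
  rw [mul_comm Complex.I, mul_smul, Complex.coe_smul, sub_right_comm]
  exact h

theorem conj_expI {u : A} (hu : u ∈ unitary A) (X : A) (s : ℝ) :
    star u * expI X s * u = expI (star u * X * u) s := by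
  let : NormedAlgebra ℚ A := NormedAlgebra.restrictScalars ℚ ℂ A
  have h := NormedSpace.exp_units_conj' (Unitary.toUnits ⟨u, hu⟩) ((Complex.I * (s : ℂ)) • X)
  rw [expI, expI, ← smul_mul_assoc, ← mul_smul_comm]
  exact h.symm

theorem heisenberg_add_time (X B : A) (s t : ℝ) :
    heisenberg X s (heisenberg X t B) = heisenberg X (s + t) B := by
  have h : expI X (-(s + t)) = expI X (-t) * expI X (-s) := by
    rw [← expI_add]; congr 1; ring
  simp only [heisenberg, expI_add X s t, h, mul_assoc]

/-- A summand of the generator that commutes with the rest of it and with the observable does not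
contribute to the Heisenberg evolution. -/
theorem heisenberg_add {X Y B : A} (hXY : Commute X Y) (hYB : Commute Y B) (s : ℝ) :
    heisenberg (X + Y) s B = heisenberg X s B := by
  have h1 : Commute (expI Y s) B := (hYB.smul_left _).exp_left
  have h2 : expI (X + Y) (-s) = expI Y (-s) * expI X (-s) := by
    rw [add_comm]; exact expI_add_left hXY.symm _
  rw [heisenberg, expI_add_left hXY, h2, heisenberg]
  calc expI X s * expI Y s * B * (expI Y (-s) * expI X (-s))
      = expI X s * (expI Y s * B) * expI Y (-s) * expI X (-s) := by
        simp only [mul_assoc]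
    _ = expI X s * B * (expI Y s * expI Y (-s)) * expI X (-s) := by
        rw [h1.eq]; simp only [mul_assoc]
    _ = _ := by rw [expI_mul_neg, mul_one]

end CStar

/-! ### Heisenberg evolution of operators on Fock space. -/

section Fock

variable {N : ℕ}

theorem propagator_conj_eq_heisenberg (X B : Op N) (s : ℝ) :
    propagator X s * B * propagator X (-s) = heisenberg X s B := rfl

theorem Op.norm_heisenberg_sub_sub_le {X : Op N} (hX : star X = X) (s : ℝ) (B : Op N) :
    ‖heisenberg X s B - B - (Complex.I * s) • (X * B - B * X)‖ ≤
      ‖X * (X * B - B * X) - (X * B - B * X) * X‖ * s ^ 2 :=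
  FermiHubbard.norm_heisenberg_sub_sub_le hX s B

theorem Op.norm_heisenberg {X : Op N} (hX : star X = X) (s : ℝ) (B : Op N) :
    ‖heisenberg X s B‖ = ‖B‖ :=
  FermiHubbard.norm_heisenberg hX s B

theorem Op.heisenberg_add {X Y B : Op N} (hXY : Commute X Y) (hYB : Commute Y B) (s : ℝ) :
    heisenberg (X + Y) s B = heisenberg X s B :=
  FermiHubbard.heisenberg_add hXY hYB s

/-- The local algebra is finite-dimensional, hence closed, so it contains the limit of the
exponential series. -/
theorem propagator_mem_supportedOn {S : Finset (Fin N)} {X : Op N} (h : X ∈ supportedOn S)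
    (s : ℝ) : propagator X s ∈ supportedOn S := by
  let : NormedAlgebra ℚ (Op N) := NormedAlgebra.restrictScalars ℚ ℂ (Op N)
  refine NormedSpace.exp_mem (R := ℂ) ?_ ((supportedOn S).smul_mem h _)
  exact (Subalgebra.toSubmodule (supportedOn S)).closed_of_finiteDimensional

theorem heisenberg_mem {S : Finset (Fin N)} {X B : Op N} (hX : X ∈ supportedOn S)
    (hB : B ∈ supportedOn S) (s : ℝ) : heisenberg X s B ∈ supportedOn S :=
  mul_mem (mul_mem (propagator_mem_supportedOn hX s) hB) (propagator_mem_supportedOn hX _)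

end Fock

/-! ### The reshaped evolution as a composition of single steps. -/

section AveragedStep

variable {A : Type*} [CStarAlgebra A]

/-- One step of the reshaped evolution. -/
noncomputable def reshapedStep (H : A) (τ : ℝ) (u B : A) : A :=
  star u * expI H τ * u * B * (star u * expI H (-τ) * u)

theorem reshapedStep_eq {u : A} (hu : u ∈ unitary A) (H : A) (τ : ℝ) (B : A) :
    reshapedStep H τ u B = heisenberg (star u * H * u) τ B := by
  rw [reshapedStep, conj_expI hu, conj_expI hu, heisenberg]

theorem star_conj {u H : A} (hH : star H = H) : star (star u * H * u) = star u * H * u := by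
  rw [star_mul, star_mul, star_star, hH, mul_assoc]

theorem norm_reshapedStep {u : A} (hu : u ∈ unitary A) {H : A} (hH : star H = H)
    (τ : ℝ) (B : A) : ‖reshapedStep H τ u B‖ = ‖B‖ := by
  rw [reshapedStep_eq hu, norm_heisenberg (star_conj hH)]

theorem reshapedStep_sub (H : A) (τ : ℝ) (u B C : A) :
    reshapedStep H τ u (B - C) = reshapedStep H τ u B - reshapedStep H τ u C := by
  simp only [reshapedStep]
  rw [mul_sub, sub_mul]

theorem continuous_reshapedStep (H : A) (τ : ℝ) :
    Continuous fun p : A × A => reshapedStep H τ p.1 p.2 := by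
  unfold reshapedStep
  fun_prop

/-- The reshaped Heisenberg evolution in a C⋆-algebra. -/
noncomputable def reshapedProduct {r : ℕ} (H : A) (τ : ℝ) (U : Fin r → A) (O : A) : A :=
  (List.ofFn fun l => star (U l) * expI H τ * U l).prod * O *
    (List.ofFn fun l => star (U l) * expI H (-τ) * U l).reverse.prod

theorem reshapedProduct_zero (H : A) (τ : ℝ) (U : Fin 0 → A) (O : A) :
    reshapedProduct H τ U O = O := by
  simp [reshapedProduct]

/-- The first unitary gives the outermost factors on both sides. Peeling it off leaves a product
that depends only on the other unitaries, which is what the induction under the expectation needs.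
-/
theorem reshapedProduct_succ {r : ℕ} (H : A) (τ : ℝ) (U : Fin (r + 1) → A) (O : A) :
    reshapedProduct H τ U O =
      reshapedStep H τ (U 0) (reshapedProduct H τ (fun l => U l.succ) O) := by
  simp only [reshapedProduct, reshapedStep, List.ofFn_succ, List.prod_cons, List.reverse_cons,
    List.prod_append, List.prod_nil, mul_one, mul_assoc]

theorem continuous_reshapedProduct (H : A) (τ : ℝ) (O : A) (r : ℕ) :
    Continuous fun U : Fin r → A => reshapedProduct H τ U O := by
  induction r with
  | zero => simp only [reshapedProduct_zero]; exact continuous_const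
  | succ r ih =>
    simp only [reshapedProduct_succ]
    have h : Continuous fun U : Fin (r + 1) → A =>
        (U 0, reshapedProduct H τ (fun l => U l.succ) O) :=
      (continuous_apply 0).prodMk (ih.comp (by fun_prop))
    exact (continuous_reshapedStep H τ).comp h

theorem norm_reshapedProduct {H : A} (hH : star H = H) (τ : ℝ) (O : A) {r : ℕ}
    {U : Fin r → A} (hU : ∀ l, U l ∈ unitary A) :
    ‖reshapedProduct H τ U O‖ = ‖O‖ := by
  induction r with
  | zero => rw [reshapedProduct_zero]
  | succ r ih => rw [reshapedProduct_succ, norm_reshapedStep (hU 0) hH, ih fun l => hU _]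

/-! ### Averaging over independent random unitaries. -/

variable [MeasurableSpace A] [BorelSpace A] [SecondCountableTopology A]

/-- The averaged step of the reshaped evolution. -/
noncomputable def averagedStep (H : A) (τ : ℝ) (D : Measure A) (B : A) : A :=
  ∫ u, reshapedStep H τ u B ∂D

theorem integrable_of_continuous {α : Type*} [MeasurableSpace α] [TopologicalSpace α]
    [OpensMeasurableSpace α] {μ : Measure α} [IsFiniteMeasure μ] {f : α → A}
    (hf : Continuous f) {c : ℝ} (hc : ∀ᵐ x ∂μ, ‖f x‖ ≤ c) : Integrable f μ := by
  refine Integrable.of_bound ?_ c hc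
  exact hf.measurable.aestronglyMeasurable

theorem integrable_conj {D : Measure A} [IsProbabilityMeasure D]
    (hD : ∀ᵐ u ∂D, u ∈ unitary A) (H : A) : Integrable (fun u => star u * H * u) D := by
  refine integrable_of_continuous (c := ‖H‖) (by fun_prop) ?_
  filter_upwards [hD] with u hu
  rw [CStarRing.norm_mul_mem_unitary _ hu, CStarRing.norm_mem_unitary_mul _ (Unitary.star_mem hu)]

/-- With `p` the fermion parity, this makes the averaged Hamiltonian even. -/
theorem commute_integral_conj {D : Measure A} [IsProbabilityMeasure D]
    (hD : ∀ᵐ u ∂D, u ∈ unitary A) {H : A} {p : A}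
    (hp : ∀ᵐ u ∂D, p * (star u * H * u) = star u * H * u * p) :
    p * (∫ u, star u * H * u ∂D) = (∫ u, star u * H * u ∂D) * p := by
  rw [← integral_const_mul_of_integrable (integrable_conj hD H),
    ← integral_mul_const_of_integrable (integrable_conj hD H)]
  exact integral_congr_ae hp

theorem integral_conj_commutator {D : Measure A} [IsProbabilityMeasure D]
    (hD : ∀ᵐ u ∂D, u ∈ unitary A) {H : A} (B : A) :
    Integrable (fun u => star u * H * u * B - B * (star u * H * u)) D ∧
    ∫ u, (star u * H * u * B - B * (star u * H * u)) ∂D =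
      (∫ u, star u * H * u ∂D) * B - B * ∫ u, star u * H * u ∂D := by
  have h := integrable_conj hD H
  refine ⟨(h.mul_const B).sub (h.const_mul B), ?_⟩
  rw [integral_sub (h.mul_const B) (h.const_mul B), integral_const_mul_of_integrable h,
    integral_mul_const_of_integrable h]

theorem norm_integral_conj_commutator_le {D : Measure A} [IsProbabilityMeasure D]
    (hD : ∀ᵐ u ∂D, u ∈ unitary A) {H : A} {B : A} {c : ℝ}
    (hc : ∀ᵐ u ∂D, ‖star u * H * u * B - B * (star u * H * u)‖ ≤ c) :
    ‖(∫ u, star u * H * u ∂D) * B - B * ∫ u, star u * H * u ∂D‖ ≤ c := by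
  rw [← (integral_conj_commutator hD B).2]
  simpa using norm_integral_le_of_norm_le_const hc

section Average

variable {D : Measure A} [IsProbabilityMeasure D] (hD : ∀ᵐ u ∂D, u ∈ unitary A)
  {H : A} (hH : star H = H)

include hD hH

theorem integrable_reshapedStep (τ : ℝ) (B : A) :
    Integrable (fun u => reshapedStep H τ u B) D := by
  refine integrable_of_continuous (c := ‖B‖)
    ((continuous_reshapedStep H τ).comp (by fun_prop : Continuous fun u : A => (u, B))) ?_
  filter_upwards [hD] with u hu
  exact (norm_reshapedStep hu hH τ B).le

/-- An average of linear isometries is a contraction. Hence errors made in earlier steps are not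
amplified by later ones. -/
theorem norm_averagedStep_sub_le (τ : ℝ) (B C : A) :
    ‖averagedStep H τ D B - averagedStep H τ D C‖ ≤ ‖B - C‖ := by
  rw [averagedStep, averagedStep, ← integral_sub (integrable_reshapedStep hD hH τ B)
    (integrable_reshapedStep hD hH τ C)]
  have h := norm_integral_le_of_norm_le_const (μ := D)
    (f := fun u => reshapedStep H τ u B - reshapedStep H τ u C) (C := ‖B - C‖) (by
      filter_upwards [hD] with u hu
      rw [← reshapedStep_sub]
      exact (norm_reshapedStep hu hH τ _).le)
  simpa using h

theorem integrable_reshapedProduct (τ : ℝ) (O : A) (r : ℕ) :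
    Integrable (fun U : Fin r → A => reshapedProduct H τ U O)
      (Measure.pi fun _ => D) := by
  refine integrable_of_continuous (c := ‖O‖) (continuous_reshapedProduct H τ O r) ?_
  have h : ∀ᵐ U : Fin r → A ∂(Measure.pi fun _ => D), ∀ l, U l ∈ unitary A :=
    ae_all_iff.2 fun l =>
      (measurePreserving_eval (fun _ : Fin r => D) l).quasiMeasurePreserving.ae hD
  filter_upwards [h] with U hU
  exact (norm_reshapedProduct hH τ O hU).le

/-- The averaged reshaped evolution over independent unitaries is the iterated averaged step. -/
theorem integral_reshapedProduct (τ : ℝ) (O : A) (r : ℕ) :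
    ∫ U : Fin r → A, reshapedProduct H τ U O ∂(Measure.pi fun _ => D) =
      (averagedStep H τ D)^[r] O := by
  induction r with
  | zero => simp [reshapedProduct_zero]
  | succ r ih =>
    have hmp := (measurePreserving_piFinSuccAbove (fun _ : Fin (r + 1) => D) 0).symm
    have hcomp : ∀ p : A × (Fin r → A),
        reshapedProduct H τ
          ((MeasurableEquiv.piFinSuccAbove (fun _ : Fin (r + 1) => A) 0).symm p) O =
        reshapedStep H τ p.1 (reshapedProduct H τ p.2 O) := fun p => by
      rw [reshapedProduct_succ]
      rfl
    have hint : Integrable (fun p : A × (Fin r → A) =>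
        reshapedStep H τ p.1 (reshapedProduct H τ p.2 O))
        (D.prod (Measure.pi fun _ => D)) := by
      have := (hmp.integrable_comp_emb (MeasurableEquiv.measurableEmbedding _)).2
        (integrable_reshapedProduct hD hH τ O (r + 1))
      exact this.congr (Filter.Eventually.of_forall hcomp)
    rw [Function.iterate_succ_apply', ← ih, ← hmp.integral_comp']
    simp only [hcomp]
    rw [averagedStep]
    -- Fubini, with the first unitary as outer variable. For fixed `u` the step is multiplication
    -- from the left and the right by constants, so the inner average passes through it.
    refine (integral_prod _ hint).trans ?_
    refine integral_congr_ae (Filter.Eventually.of_forall fun u => ?_)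
    have hF := integrable_reshapedProduct hD hH τ O r
    simp only [reshapedStep]
    refine (integral_mul_const_of_integrable
      (f := fun y => star u * expI H τ * u * reshapedProduct H τ y O) (hF.const_mul _)).trans ?_
    rw [integral_const_mul_of_integrable hF]

/-- Independence identifies the joint law of the unitaries with the product measure, to which the
expectation is transported. -/
theorem reshapedProduct_expectation {Ω : Type*} [MeasurableSpace Ω] {P : Measure Ω}
    [IsProbabilityMeasure P] {r : ℕ} {U : Fin r → Ω → A} (hU : ∀ l, HasLaw (U l) D P)
    (hind : iIndepFun U P) (τ : ℝ) (O : A) :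
    Integrable (fun ω => reshapedProduct H τ (fun l => U l ω) O) P ∧
      ∫ ω, reshapedProduct H τ (fun l => U l ω) O ∂P = (averagedStep H τ D)^[r] O := by
  have hm : ∀ l, AEMeasurable (U l) P := fun l => (hU l).aemeasurable
  have hmap : P.map (fun ω l => U l ω) = Measure.pi fun _ => D := by
    rw [(iIndepFun_iff_map_fun_eq_pi_map hm).1 hind]
    simp only [(hU _).map_eq]
  have hint := integrable_reshapedProduct hD hH τ O r
  rw [← integral_reshapedProduct hD hH τ O r]
  rw [← hmap] at hint ⊢
  exact ⟨hint.comp_aemeasurable (aemeasurable_pi_iff.2 hm),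
    (integral_map (aemeasurable_pi_iff.2 hm) hint.aestronglyMeasurable).symm⟩

theorem star_integral_conj : star (∫ u, star u * H * u ∂D) = ∫ u, star u * H * u ∂D := by
  have h := (starL' ℝ : A ≃L[ℝ] A).toContinuousLinearMap.integral_comp_comm
    (integrable_conj hD H)
  refine h.symm.trans (integral_congr_ae (Filter.Eventually.of_forall fun u => ?_))
  exact star_conj hH

/-- To first order, the averaged step is generated by the averaged Hamiltonian. -/
theorem norm_averagedStep_sub_sub_le (τ : ℝ) {B : A} {c : ℝ}
    (hc : ∀ᵐ u ∂D, ‖star u * H * u * (star u * H * u * B - B * (star u * H * u)) -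
      (star u * H * u * B - B * (star u * H * u)) * (star u * H * u)‖ ≤ c) :
    ‖averagedStep H τ D B - B - (Complex.I * τ) •
      ((∫ u, star u * H * u ∂D) * B - B * ∫ u, star u * H * u ∂D)‖ ≤ c * τ ^ 2 := by
  obtain ⟨h1, h2⟩ := integral_conj_commutator hD B
  have h3 := integrable_reshapedStep hD hH τ B
  have h4 : averagedStep H τ D B - B - (Complex.I * τ) •
      ((∫ u, star u * H * u ∂D) * B - B * ∫ u, star u * H * u ∂D) =
      ∫ u, (reshapedStep H τ u B - B - (Complex.I * τ) •
        (star u * H * u * B - B * (star u * H * u))) ∂D := by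
    have h5 := integral_sub (h3.sub (integrable_const B)) (h1.smul (Complex.I * (τ : ℂ)))
    have h6 := integral_sub h3 (integrable_const (μ := D) B)
    rw [integral_const, probReal_univ, one_smul] at h6
    have h7 := integral_smul (μ := D) (Complex.I * (τ : ℂ))
      (fun u => star u * H * u * B - B * (star u * H * u))
    rw [h2] at h7
    rw [averagedStep, ← h6, ← h7]
    exact h5.symm
  rw [h4]
  have h8 := norm_integral_le_of_norm_le_const (μ := D) (C := c * τ ^ 2)
    (f := fun u => reshapedStep H τ u B - B - (Complex.I * τ) •
        (star u * H * u * B - B * (star u * H * u))) (by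
      filter_upwards [hD, hc] with u hu hcu
      rw [reshapedStep_eq hu]
      exact (norm_heisenberg_sub_sub_le (star_conj hH) τ B).trans
        (mul_le_mul_of_nonneg_right hcu (sq_nonneg _)))
  simpa using h8

/-- If the averaged step and the Heisenberg evolution of `X` agree up to `ε` on a set containing the
orbit of `O`, then their `n`-th iterates agree up to `n * ε`. -/
theorem norm_iterate_averagedStep_sub_le {X O : A} {τ ε : ℝ} {V : Set A}
    (hV : ∀ s, heisenberg X s O ∈ V)
    (hε : ∀ B ∈ V, ‖averagedStep H τ D B - heisenberg X τ B‖ ≤ ε) (n : ℕ) :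
    ‖(averagedStep H τ D)^[n] O - heisenberg X (n * τ) O‖ ≤ n * ε := by
  induction n with
  | zero => simp [heisenberg_zero]
  | succ n ih =>
    have h1 : heisenberg X ((n + 1 : ℕ) * τ) O = heisenberg X τ (heisenberg X (n * τ) O) := by
      rw [heisenberg_add_time]; congr 1; push_cast; ring
    rw [Function.iterate_succ_apply', h1]
    -- The intermediate point is one averaged step from the exact orbit: contraction carries over
    -- the old error, and the one-step estimate is needed only at a point of `V`.
    have h2 := norm_sub_le_norm_sub_add_norm_sub (averagedStep H τ D ((averagedStep H τ D)^[n] O))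
      (averagedStep H τ D (heisenberg X (n * τ) O)) (heisenberg X τ (heisenberg X (n * τ) O))
    have h3 := norm_averagedStep_sub_le hD hH τ ((averagedStep H τ D)^[n] O)
      (heisenberg X (n * τ) O)
    have h4 := hε _ (hV (n * τ))
    push_cast
    linarith

end Average

end AveragedStep

/-! ### The effective Hamiltonian and the error of one averaged step. -/

theorem reshapedEvolution_eq {N r : ℕ} (H : Op N) (τ : ℝ) (U : Fin r → Op N) (O : Op N) :
    reshapedEvolution H τ U O = reshapedProduct H τ U O := rfl

variable {N : ℕ} {G : SimpleGraph (Fin N)} [DecidableRel G.Adj] {h : Fin N → Fin N → ℝ}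
  {ξ : Fin N → ℝ}

/-- The norm of the double commutator of the conjugated Hamiltonian with a local operator is
bounded independently of the size of the system. -/
theorem norm_conj_hamiltonian_commutator_commutator_le {k d : ℕ} (hd : ∀ i, G.degree i ≤ d)
    (hh : ∀ i j, G.Adj i j → |h i j| ≤ 1) (hξ : ∀ i, |ξ i| ≤ 1)
    {u : Op N} (hu : u ∈ productUnitaries N)
    {S : Finset (Fin N)} (hS : S.card ≤ k) {B : Op N} (hB : B ∈ supportedOn S) :
    ‖star u * hamiltonian G h ξ * u *
        (star u * hamiltonian G h ξ * u * B - B * (star u * hamiltonian G h ξ * u)) -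
      (star u * hamiltonian G h ξ * u * B - B * (star u * hamiltonian G h ξ * u)) *
        (star u * hamiltonian G h ξ * u)‖ ≤
      (k * (d + 1) * (d + 1) : ℕ) * (d + 1) * (2 * (2 * d + 1)) *
        (k * (d + 1) * (2 * (2 * d + 1)) * ‖B‖) := by
  have hcard : (thicken G (thicken G S)).card ≤ k * (d + 1) * (d + 1) :=
    (card_thicken_le hd _).trans (Nat.mul_le_mul_right _
      ((card_thicken_le hd _).trans (Nat.mul_le_mul_right _ hS)))
  refine (norm_conj_hamiltonian_commutator_le hd hh hξ hu hcard
    (conj_hamiltonian_commutator_mem hu hB)).trans ?_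
  gcongr
  exact norm_conj_hamiltonian_commutator_le hd hh hξ hu hS hB

theorem eq_half_smul_add_half_smul {E : Type*} [AddCommGroup E] [Module ℂ E] (a b : E) :
    a = (1 / 2 : ℂ) • (a + b) + (1 / 2 : ℂ) • (a - b) := by
  rw [← smul_add, add_add_sub_cancel, ← two_smul ℂ, smul_smul]
  norm_num

/-- A self-adjoint even operator that splits over a set of sites and its complement: the summand
on the set is, up to an operator commuting with the local algebra, self-adjoint, and the commutator
with local operators only sees this self-adjoint part. -/
theorem exists_selfAdjoint_part {C : Finset (Fin N)} {A Heff Henv : Op N}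
    (hsum : A = Heff + Henv) (hA : star A = A) (hAe : IsEven A)
    (heff : Heff ∈ supportedOn C) (henv : Henv ∈ supportedOn Cᶜ) :
    ∃ X ∈ supportedOn C, star X = X ∧
      (∀ B ∈ supportedOn C, A * B - B * A = X * B - B * X) ∧
      ∀ B ∈ supportedOn C, ∀ s, heisenberg Heff s B = heisenberg X s B := by
  have hdisj : Disjoint C Cᶜ := disjoint_compl_right
  have heven : IsEven Heff := isEven_of_isEven_add hdisj heff henv (hsum ▸ hAe)
  have hevenv : IsEven Henv := by
    have h1 : Henv = A - Heff := by rw [hsum, add_sub_cancel_left]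
    rw [h1]; exact hAe.sub heven
  set X : Op N := (1 / 2 : ℂ) • (Heff + star Heff) with hX
  set Y : Op N := (1 / 2 : ℂ) • (Heff - star Heff) with hY
  have hXmem : X ∈ supportedOn C :=
    (supportedOn C).smul_mem (add_mem heff (star_mem_supportedOn heff)) _
  have hXY : Heff = X + Y := eq_half_smul_add_half_smul Heff (star Heff)
  -- As `A` is self-adjoint, the anti-self-adjoint parts of `Heff` and `Henv` cancel. So `Y` is also
  -- supported on the complement of `C`, and being even it commutes with the algebra of `C`, in
  -- particular with `X`.
  have hYenv : Y = (1 / 2 : ℂ) • (star Henv - Henv) := by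
    rw [hY]
    congr 1
    rw [hsum, Op.star_add] at hA
    rw [sub_eq_sub_iff_add_eq_add, ← hA, add_comm]
  have hYmem : Y ∈ supportedOn Cᶜ := by
    rw [hYenv]
    exact (supportedOn Cᶜ).smul_mem (sub_mem (star_mem_supportedOn henv) henv) _
  have hYeven : IsEven Y := (heven.sub heven.star).smul _
  have hYcomm : ∀ B ∈ supportedOn C, Commute Y B := fun B hB =>
    hYeven.commute hdisj.symm hYmem hB
  refine ⟨X, hXmem, ?_, fun B hB => ?_, fun B hB s => ?_⟩
  · rw [hX, star_smul, Op.star_add, star_star, add_comm]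
    congr 1
    simp
  · have h1 : Commute (Y + Henv) B :=
      (hYcomm B hB).add_left (hevenv.commute hdisj.symm henv hB)
    have h2 : A = X + (Y + Henv) := by rw [hsum, hXY, add_assoc]
    rw [h2, add_mul, mul_add, h1.eq, add_sub_add_right_eq_sub]
  · rw [hXY]
    exact Op.heisenberg_add (hYcomm X hXmem).symm (hYcomm B hB) s

/-- Error of one averaged step on operators of norm at most one that are supported on `C`. -/
theorem norm_averagedStep_sub_heisenberg_le {k d : ℕ} (hd : ∀ i, G.degree i ≤ d)
    (hsymm : ∀ i j, G.Adj i j → h i j = h j i)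
    (hh : ∀ i j, G.Adj i j → |h i j| ≤ 1) (hξ : ∀ i, |ξ i| ≤ 1)
    {C : Finset (Fin N)} (hC : C.card ≤ k) {D : Measure (Op N)} [IsProbabilityMeasure D]
    (hD : ∀ᵐ u ∂D, u ∈ productUnitaries N) {X : Op N} (hXC : X ∈ supportedOn C)
    (hX : star X = X)
    (hcomm : ∀ B ∈ supportedOn C,
      (∫ u, star u * hamiltonian G h ξ * u ∂D) * B - B * ∫ u, star u * hamiltonian G h ξ * u ∂D =
        X * B - B * X)
    (τ : ℝ) {B : Op N} (hB : B ∈ supportedOn C) (hB1 : ‖B‖ ≤ 1) :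
    ‖averagedStep (hamiltonian G h ξ) τ D B - heisenberg X τ B‖ ≤
      ((k * (d + 1) * (d + 1) : ℕ) * (d + 1) * (2 * (2 * d + 1)) *
        (k * (d + 1) * (2 * (2 * d + 1))) + (k * (d + 1) * (2 * (2 * d + 1))) ^ 2) * τ ^ 2 := by
  have hDu : ∀ᵐ u ∂D, u ∈ unitary (Op N) := hD.mono fun u hu => (productUnitaries_conj hu).1
  have hH := hamiltonian_star (G := G) (ξ := ξ) hsymm
  set M : ℝ := k * (d + 1) * (2 * (2 * d + 1)) with hM
  set L : ℝ := (k * (d + 1) * (d + 1) : ℕ) * (d + 1) * (2 * (2 * d + 1)) with hL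
  have hM0 : 0 ≤ M := by positivity
  have hL0 : 0 ≤ L := by positivity
  -- No bound on `‖X‖` is needed: on the algebra of `C` the commutator with `X` is the average of
  -- commutators with the conjugated Hamiltonians, which are bounded uniformly.
  have hXB : ∀ B ∈ supportedOn C, ‖X * B - B * X‖ ≤ M * ‖B‖ := fun B hB => by
    rw [← hcomm B hB]
    refine norm_integral_conj_commutator_le hDu ?_
    filter_upwards [hD] with u hu
    exact norm_conj_hamiltonian_commutator_le hd hh hξ hu hC hB
  have h1 : ‖averagedStep (hamiltonian G h ξ) τ D B - B -
      (Complex.I * τ) • (X * B - B * X)‖ ≤ L * M * τ ^ 2 := by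
    rw [← hcomm B hB]
    refine norm_averagedStep_sub_sub_le hDu hH τ ?_
    filter_upwards [hD] with u hu
    refine (norm_conj_hamiltonian_commutator_commutator_le hd hh hξ hu hC hB).trans ?_
    exact mul_le_mul_of_nonneg_left (mul_le_of_le_one_right hM0 hB1) hL0
  have h2 : ‖heisenberg X τ B - B - (Complex.I * τ) • (X * B - B * X)‖ ≤ M ^ 2 * τ ^ 2 := by
    refine (Op.norm_heisenberg_sub_sub_le hX τ B).trans ?_
    refine mul_le_mul_of_nonneg_right ?_ (sq_nonneg _)
    -- Commuting with `X` does not leave the algebra of `C`, so the same bound `M` applies twice;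
    -- for the conjugated Hamiltonian the support grows, whence the larger `L`.
    refine (hXB _ (sub_mem (mul_mem hXC hB) (mul_mem hB hXC))).trans ?_
    rw [sq]
    exact mul_le_mul_of_nonneg_left ((hXB B hB).trans (mul_le_of_le_one_right hM0 hB1)) hM0
  -- Both evolutions are compared with the same first-order polynomial in `τ`, which cancels in the
  -- difference.
  have h3 := norm_sub_le (averagedStep (hamiltonian G h ξ) τ D B - B -
    (Complex.I * τ) • (X * B - B * X)) (heisenberg X τ B - B - (Complex.I * τ) • (X * B - B * X))
  rw [sub_sub_sub_cancel_right, sub_sub_sub_cancel_right] at h3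
  linarith

end FermiHubbard

/-! ### The error bound for the averaged reshaped evolution. -/

theorem theorem2 (k d : ℕ) :
    ∃ K : ℝ, ∀ (N : ℕ) (G : SimpleGraph (Fin N)) [DecidableRel G.Adj]
      (h : Fin N → Fin N → ℝ) (ξ : Fin N → ℝ)
      (C : Finset (Fin N)) (Heff Henv : Op N)
      (D : Measure (Op N)) [IsProbabilityMeasure D]
      {Ω : Type*} [MeasurableSpace Ω] (P : Measure Ω) [IsProbabilityMeasure P]
      (r : ℕ) (U : Fin r → Ω → Op N) (t : ℝ) (O : Op N),
      (∀ i, G.degree i ≤ d) →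
      (∀ i j, G.Adj i j → h i j = h j i) → (∀ i j, G.Adj i j → |h i j| ≤ 1) →
      (∀ i, |ξ i| ≤ 1) →
      C.card ≤ k →
      (∀ᵐ u ∂D, u ∈ productUnitaries N) →
      ∫ u, star u * hamiltonian G h ξ * u ∂D = Heff + Henv →
      Heff ∈ supportedOn C → Henv ∈ supportedOn Cᶜ →
      0 < r → (∀ l, HasLaw (U l) D P) → iIndepFun U P →
      O ∈ supportedOn C → ‖O‖ ≤ 1 →
      Integrable (fun ω => reshapedEvolution (hamiltonian G h ξ) (t / r) (fun l => U l ω) O) P ∧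
      ‖(∫ ω, reshapedEvolution (hamiltonian G h ξ) (t / r) (fun l => U l ω) O ∂P)
          - propagator Heff t * O * propagator Heff (-t)‖ ≤ K * (t ^ 2 / r) := by
  -- The first summand is the second-order remainder of the averaged step, the second that of the
  -- effective evolution.
  refine ⟨(k * (d + 1) * (d + 1) : ℕ) * (d + 1) * (2 * (2 * d + 1)) *
    (k * (d + 1) * (2 * (2 * d + 1))) + (k * (d + 1) * (2 * (2 * d + 1))) ^ 2, ?_⟩
  intro N G _ h ξ C Heff Henv D _ Ω _ P _ r U t O hd hsymm hh hξ hC hD hsum heff henv hr hU hind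
    hO hO1
  have hDu : ∀ᵐ u ∂D, u ∈ unitary (Op N) := hD.mono fun u hu => (productUnitaries_conj hu).1
  have hH := hamiltonian_star (G := G) (ξ := ξ) hsymm
  have heven : IsEven (∫ u, star u * hamiltonian G h ξ * u ∂D) :=
    commute_integral_conj hDu
      (hD.mono fun u hu => (productUnitaries_conj hu).2.2 _ (hamiltonian_isEven G h ξ))
  obtain ⟨X, hXC, hX, hcomm, hevol⟩ := exists_selfAdjoint_part hsum
    (star_integral_conj hDu hH) heven heff henv
  obtain ⟨hint, hval⟩ := reshapedProduct_expectation hDu hH hU hind (t / r) O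
  refine ⟨hint, ?_⟩
  simp only [reshapedEvolution_eq]
  rw [propagator_conj_eq_heisenberg, hevol O hO]
  refine (congrArg (fun Z => ‖Z - heisenberg X t O‖) hval).trans_le ?_
  have hr0 : (r : ℝ) ≠ 0 := by exact_mod_cast hr.ne'
  -- The unit ball of the algebra of `C` contains the whole exact orbit, because `X` lies in that
  -- algebra and is self-adjoint.
  have hmain := norm_iterate_averagedStep_sub_le hDu hH (X := X) (O := O) (τ := t / r)
    (V := {B | B ∈ supportedOn C ∧ ‖B‖ ≤ 1})
    (fun s => ⟨heisenberg_mem hXC hO s, (Op.norm_heisenberg hX s O).trans_le hO1⟩)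
    (fun B hB => norm_averagedStep_sub_heisenberg_le hd hsymm hh hξ hC hD hXC hX hcomm
      (t / r) hB.1 hB.2) r
  rw [mul_div_cancel₀ t hr0] at hmain
  refine hmain.trans_eq ?_
  field_simp
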